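/- **Theorem (Correspondence principle).** Let $G$ be a locally compact, Hausdorff, second countable topological group with left Haar measure $\mathrm{m}$, and suppose that $G$ is amenable, i.e. $L^\infty(G,\mathrm m)$ has a left-invariant mean. Let $\triangle$ be the modular function, normalised by $\triangle(g)\int |f(xg)|\,\mathrm{dm}(x)=\int |f|\,\mathrm{dm}$ for $f \in L^1(G,\mathrm m)$. A *two-sided Reiter sequence* is a sequence $\Phi=(\Phi_N)$ of non-negative functions in $L^1(G,\mathrm m)$ with $\int\Phi_N\,\mathrm{dm}=1$ such that, for every $g\in G$, $$\int |\Phi_N(g^{-1}x)-\Phi_N(x)|\,\mathrm{dm}(x)\to 0,\qquad \int |\triangle(g)\Phi_N(xg)-\Phi_N(x)|\,\mathrm{dm}(x)\to 0 \qquad (N\to\infty),$$ and the upper density of a measurable set $E\subseteq G$ with respect to $\Phi$ is $\bar{\mathrm d}_\Phi(E)=\limsup_{N\to\infty}\int_E\Phi_N\,\mathrm{dm}$. Let $\Phi$ be a two-sided Reiter sequence, let $W\subseteq G$ be Borel, let $U$ be an open neighbourhood of the identity, and let $S\supseteq UWU$ be ($\mathrm m$-)measurable. Then there are a compact metric space $X$,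 a jointly continuous left action of $G\times G$ on $X$, given by commuting actions $L,R$ of $G$ through $(g,h)x=L^gR^hx$, and a continuous function $\xi:X\to[0,\infty)$ such that, writing $L^gR^h\xi$ for the function $x\mapsto\xi(L^gR^hx)$, the following hold. 1. There is an $L\times R$-invariant Borel probability measure $\mu$ on $X$ with $\int\xi\,\mathrm d\mu=\bar{\mathrm d}_\Phi(W)$ and $$\bar{\mathrm d}_\Phi(g_1^{-1}Sh_1\cap\dots\cap g_n^{-1}Sh_n)\ \ge\ \int L^{g_1}R^{h_1}\xi\cdots L^{g_n}R^{h_n}\xi\,\mathrm d\mu$$ for all $n$ and all $g_1,\dots,g_n,h_1,\dots,h_n\in G$. 2. There are an ergodic $L\times R$-invariant Borel probability measure $\nu$ on $X$ and a two-sided Reiter sequence $\Psi$ with $\int\xi\,\mathrm d\nu\ge\bar{\mathrm d}_\Phi(W)$ and $$\bar{\mathrm d}_\Psi(g_1^{-1}Sh_1\cap\dots\cap g_n^{-1}Sh_n)\ \ge\ \int L^{g_1}R^{h_1}\xi\cdots L^{g_n}R^{h_n}\xi\,\mathrm d\nu$$ for all $n$ and all $g_1,\dots,g_n,h_1,\dots,h_n\in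 G$. If $G$ is discrete, then $\xi$ can moreover be taken to be the characteristic function of a clopen subset of $X$. -/

import Mathlib

open MeasureTheory Filter
open scoped Topology Pointwise ENNReal

universe u

noncomputable section

/-- `L^∞(G, m)` has a left-invariant mean: a positive linear functional `M` with `M 1 = 1` and
`M (l_g f) = M f`, where `(l_g f)(x) = f (g⁻¹ x)`. -/
def IsAmenableGroup {G : Type*} [Group G] [MeasurableSpace G] (m : Measure G) : Prop :=
  ∃ M : Lp ℝ (⊤ : ℝ≥0∞) m →ₗ[ℝ] ℝ,
    (∀ f : Lp ℝ (⊤ : ℝ≥0∞) m, 0 ≤ f → 0 ≤ M f) ∧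
    (∀ f : Lp ℝ (⊤ : ℝ≥0∞) m, (f : G → ℝ) =ᵐ[m] (fun _ => 1) → M f = 1) ∧
    (∀ (g : G) (f f' : Lp ℝ (⊤ : ℝ≥0∞) m),
      (f' : G → ℝ) =ᵐ[m] (fun x => f (g⁻¹ * x)) → M f' = M f)

section

variable {G : Type*} [TopologicalSpace G] [Group G] [IsTopologicalGroup G]
  [LocallyCompactSpace G]

/-- The modular function `Δ`, normalised by `Δ(g) ∫ |f (x g)| dm(x) = ∫ |f(x)| dm(x)` for a left
Haar measure `m`. Mathlib's `modularCharacter` has the reciprocal normalisation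
`∫ f (x g) dm(x) = modularCharacter g * ∫ f dm`. -/
def modularFn (g : G) : ℝ := ((Measure.modularCharacter g : NNReal) : ℝ)⁻¹

/-- The normalisation of the modular function. -/
theorem modularFn_mul_integral [SecondCountableTopology G] [MeasurableSpace G] [BorelSpace G]
    (m : Measure G) [m.IsHaarMeasure] (g : G) (f : G → ℝ) :
    modularFn g * ∫ x, |f (x * g)| ∂m = ∫ x, |f x| ∂m := by
  have h1 : Measure.map (· * g) m = (Measure.modularCharacter g : NNReal) • m :=
    Measure.map_right_mul_eq_modularCharacterFun_smul m g
  have h2 : ∫ x, |f (x * g)| ∂m = ∫ x, |f x| ∂(Measure.map (· * g) m) :=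
    ((MeasurableEquiv.mulRight g).measurableEmbedding.integral_map (fun x => |f x|)).symm
  have h3 : ((Measure.modularCharacter g : NNReal) : ℝ) ≠ 0 := by
    have := Measure.modularCharacterFun_pos g
    exact_mod_cast this.ne'
  rw [h2, h1, integral_smul_nnreal_measure, modularFn, NNReal.smul_def, smul_eq_mul,
    inv_mul_cancel_left₀ h3]

variable [MeasurableSpace G]

/-- Two-sided Reiter sequences: non-negative elements `Φ N` of `L¹(G, m)` of integral `1` with
`‖l_g (Φ N) - Φ N‖₁ → 0` and `‖Δ(g) r_g (Φ N) - Φ N‖₁ → 0` for every `g`, where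
`(l_g f)(x) = f (g⁻¹ x)` and `(r_g f)(x) = f (x g)`. -/
structure IsTwoSidedReiter (m : Measure G) (Φ : ℕ → G → ℝ) : Prop where
  integrable : ∀ N, Integrable (Φ N) m
  nonneg : ∀ N, 0 ≤ᵐ[m] Φ N
  integral_eq_one : ∀ N, ∫ x, Φ N x ∂m = 1
  left : ∀ g : G, Tendsto (fun N => ∫ x, |Φ N (g⁻¹ * x) - Φ N x| ∂m) atTop (𝓝 0)
  right : ∀ g : G, Tendsto (fun N => ∫ x, |modularFn g * Φ N (x * g) - Φ N x| ∂m) atTop (𝓝 0)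

end

/-- The upper density of `E` with respect to `Φ`. -/
def upperDensity {G : Type*} [MeasurableSpace G] (m : Measure G) (Φ : ℕ → G → ℝ) (E : Set G) : ℝ :=
  limsup (fun N => ∫ x in E, Φ N x ∂m) atTop

/-- The intersection of the sets `g_i⁻¹ S h_i`. -/
def interTranslates {G : Type*} [Group G] (S : Set G) {n : ℕ} (g h : Fin n → G) : Set G :=
  ⋂ i, (fun s => (g i)⁻¹ * s * h i) '' S

/-- For commuting actions `L`, `R` of `G`, encoded as one action of `G × G` by
`L^g R^h x = (g, h) • x`, this is the function `L^g R^h ξ`, i.e. `x ↦ ξ (L^g R^h x)`. -/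
def actFun {G X : Type*} [Group G] [MulAction (G × G) X] (g h : G) (ξ : X → ℝ) : X → ℝ :=
  fun x => ξ ((g, h) • x)

end

/-! The indicator function of `W` is replaced by a function `f`, its average over the translates by
a small compact `K × K` inside `U`. Three facts make this replacement harmless. `f` is uniformly
continuous for two-sided translation (`isBiUniform_smoothing`). It takes values in [0, 1] and
vanishes off `U * W * U`, so products of its translates lie below indicators of intersections of
translates of `S` (`integral_prodActFun_le`). Asymptotic invariance of `Φ` gives `f` and the
indicator of `W` the same asymptotic averages (`IsTwoSidedReiter.tendsto_smoothing`).

By uniform continuity, `f` extends to a continuous `ξ` on a metrizable compact `G × G`-space `X`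
containing a dense image `ι` of `G` (`exists_compact_model`). The densities `Φ N`, pushed to `X` by
`ι`, converge along an ultrafilter realising the upper density of `W`. The limit is an invariant
state with the right value at `ξ`, and it represents `μ`.

Invariant states form a compact convex set whose extreme points are ergodic. The face on which the
value at `ξ` is maximal contains an extreme point, and this gives `ν` (`exists_ergodic_le`). This
`ν` need not be a limit of the `Φ N`, so a new Reiter sequence is needed. If `a` and `b` are
independent with density `φ = Φ N`, the density of `a * x * b` is the convolution of `φ` with a left
translate of `φ`. Its translation defects are at most those of `φ`, whatever `x` is. Mixing such
densities over `x` keeps the bounds, and by density of `ι` the mixtures can imitate averaging over a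
`ν`-random point. That average integrates like `ν`, by invariance (`exists_mem_reiterSet_approx`).
-/

set_option linter.unusedSectionVars false

/-! ### Invariant states, invariant measures and ergodicity -/

section States

variable {X : Type*} [MetricSpace X] [CompactSpace X]

/-- The states on `C(X, ℝ)`: normalised positive functionals. -/
def stateSpace (X : Type*) [MetricSpace X] [CompactSpace X] : Set (WeakDual ℝ C(X, ℝ)) :=
  {Λ | (∀ k : C(X, ℝ), 0 ≤ k → 0 ≤ Λ k) ∧ Λ 1 = 1}

theorem stateSpace_isClosed : IsClosed (stateSpace X) := by
  have h : stateSpace X = (⋂ k : C(X, ℝ), ⋂ _ : 0 ≤ k, {Λ : WeakDual ℝ C(X, ℝ) | 0 ≤ Λ k}) ∩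
      {Λ | Λ 1 = 1} := by
    ext Λ; simp [stateSpace]
  rw [h]
  exact (isClosed_iInter fun k => isClosed_iInter fun _ =>
    isClosed_le continuous_const (WeakDual.eval_continuous k)).inter
    (isClosed_eq (WeakDual.eval_continuous 1) continuous_const)

theorem abs_state_le {Λ : WeakDual ℝ C(X, ℝ)} (hΛ : Λ ∈ stateSpace X) (k : C(X, ℝ)) :
    |Λ k| ≤ ‖k‖ := by
  have h1 : 0 ≤ Λ (‖k‖ • (1 : C(X, ℝ)) - k) := hΛ.1 _ fun x => by
    simpa using (le_abs_self _).trans (k.norm_coe_le_norm x)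
  have h2 : 0 ≤ Λ (‖k‖ • (1 : C(X, ℝ)) + k) := hΛ.1 _ fun x => by
    have := (neg_le_abs (k x)).trans (k.norm_coe_le_norm x)
    change 0 ≤ ‖k‖ * 1 + k x
    linarith
  rw [map_sub, map_smul, hΛ.2, smul_eq_mul, mul_one] at h1
  rw [map_add, map_smul, hΛ.2, smul_eq_mul, mul_one] at h2
  exact abs_le.2 ⟨by linarith, by linarith⟩

theorem stateSpace_isCompact : IsCompact (stateSpace X) := by
  refine (WeakDual.isCompact_closedBall (𝕜 := ℝ) (E := C(X, ℝ)) 0 1).of_isClosed_subset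
    stateSpace_isClosed fun Λ hΛ => ?_
  rw [Set.mem_preimage, mem_closedBall_zero_iff]
  refine ContinuousLinearMap.opNorm_le_bound _ zero_le_one fun k => ?_
  rw [one_mul]
  exact abs_state_le hΛ k

variable {H : Type*} [Group H] [MulAction H X]

/-- The states on `C(X, ℝ)` that are invariant under the action of `H`. -/
def invariantStates (H X : Type*) [MetricSpace X] [CompactSpace X] [Group H] [MulAction H X] :
    Set (WeakDual ℝ C(X, ℝ)) :=
  {Λ ∈ stateSpace X | ∀ (g : H) (k k' : C(X, ℝ)), (∀ x, k' x = k (g • x)) → Λ k' = Λ k}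

theorem invariantStates_isClosed : IsClosed (invariantStates H X) := by
  have h : invariantStates H X = stateSpace X ∩ ⋂ (g : H) (k : C(X, ℝ)) (k' : C(X, ℝ))
      (_ : ∀ x, k' x = k (g • x)), {Λ : WeakDual ℝ C(X, ℝ) | Λ k' = Λ k} := by
    ext Λ; simp [invariantStates]
  rw [h]
  exact stateSpace_isClosed.inter <| isClosed_iInter fun g => isClosed_iInter fun k =>
    isClosed_iInter fun k' => isClosed_iInter fun _ =>
      isClosed_eq (WeakDual.eval_continuous k') (WeakDual.eval_continuous k)

variable [MeasurableSpace X] [BorelSpace X]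

theorem ContinuousMap.integrable_of_compactSpace (k : C(X, ℝ)) (μ : Measure X)
    [IsFiniteMeasure μ] : Integrable k μ :=
  (BoundedContinuousFunction.mkOfCompact k).integrable μ

theorem exists_state_of_measure (μ : Measure X) [IsProbabilityMeasure μ] :
    ∃ Λ ∈ stateSpace X, ∀ k : C(X, ℝ), Λ k = ∫ x, k x ∂μ := by
  let l : C(X, ℝ) →ₗ[ℝ] ℝ :=
    { toFun := fun k => ∫ x, k x ∂μ
      map_add' := fun k k' =>
        integral_add (k.integrable_of_compactSpace μ) (k'.integrable_of_compactSpace μ)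
      map_smul' := fun c k => integral_const_mul c _ }
  refine ⟨l.mkContinuous 1 fun k => ?_, ⟨fun k hk => ?_, ?_⟩, fun k => rfl⟩
  · rw [one_mul]
    refine (norm_integral_le_of_norm_le_const
      (Eventually.of_forall fun x => k.norm_coe_le_norm x)).trans ?_
    simp
  · exact integral_nonneg hk
  · change ∫ x, (1 : C(X, ℝ)) x ∂μ = 1
    simp

theorem measure_eq_of_integral_continuousMap {Y : Type*} [MetricSpace Y] [MeasurableSpace Y]
    [BorelSpace Y] {μ ν : Measure Y} [IsFiniteMeasure μ] [IsFiniteMeasure ν] (h : ∀ k : C(Y, ℝ), ∫ x, k x ∂μ = ∫ x, k x ∂ν) : μ = ν :=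
  ext_of_forall_integral_eq_of_IsFiniteMeasure fun f => h f.toContinuousMap

theorem exists_measure_of_state {Λ : WeakDual ℝ C(X, ℝ)} (hΛ : Λ ∈ stateSpace X) :
    ∃ μ : Measure X, IsProbabilityMeasure μ ∧ ∀ k : C(X, ℝ), ∫ x, k x ∂μ = Λ k := by
  let l : CompactlySupportedContinuousMap X ℝ →ₗ[ℝ] ℝ :=
    { toFun := fun k => Λ k.toContinuousMap
      map_add' := fun k k' => map_add Λ k.toContinuousMap k'.toContinuousMap
      map_smul' := fun c k => map_smul Λ c k.toContinuousMap }
  let p : CompactlySupportedContinuousMap X ℝ →ₚ[ℝ] ℝ :=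
    PositiveLinearMap.mk₀ l fun k hk => hΛ.1 _ hk
  have hp : ∀ k : C(X, ℝ), ∫ x, k x ∂(RealRMK.rieszMeasure p) = Λ k := fun k =>
    RealRMK.integral_rieszMeasure p (CompactlySupportedContinuousMap.continuousMapEquiv k)
  have hfin : IsFiniteMeasure (RealRMK.rieszMeasure p) := by
    have : IsFiniteMeasureOnCompacts (RealRMK.rieszMeasure p) := inferInstance
    infer_instance
  refine ⟨RealRMK.rieszMeasure p, ⟨?_⟩, hp⟩
  have h1 := hp 1
  rw [hΛ.2] at h1
  simp only [ContinuousMap.one_apply, integral_const, smul_eq_mul, mul_one] at h1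
  rwa [Measure.real, ENNReal.toReal_eq_one_iff] at h1

variable [ContinuousConstSMul H X]

theorem smulInvariant_of_state {Λ : WeakDual ℝ C(X, ℝ)} (hΛ : Λ ∈ invariantStates H X)
    {μ : Measure X} [IsProbabilityMeasure μ] (hμ : ∀ k : C(X, ℝ), ∫ x, k x ∂μ = Λ k) :
    SMulInvariantMeasure H X μ := by
  suffices h : ∀ g : H, μ.map (g • ·) = μ from ⟨fun g s hs => by
    conv_rhs => rw [← h g, Measure.map_apply (continuous_const_smul g).measurable hs]⟩
  intro g
  have hm : Measurable (fun x : X => g • x) := (continuous_const_smul g).measurable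
  have : IsProbabilityMeasure (μ.map (g • ·)) := Measure.isProbabilityMeasure_map hm.aemeasurable
  refine measure_eq_of_integral_continuousMap fun k => ?_
  rw [integral_map hm.aemeasurable k.continuous.aestronglyMeasurable, hμ k,
    ← hΛ.2 g k (k.comp ⟨_, continuous_const_smul g⟩) fun x => rfl, ← hμ]
  rfl

theorem state_mem_invariantStates {Λ : WeakDual ℝ C(X, ℝ)} (hΛ : Λ ∈ stateSpace X)
    {μ : Measure X} [SMulInvariantMeasure H X μ] (hμ : ∀ k : C(X, ℝ), Λ k = ∫ x, k x ∂μ) :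
    Λ ∈ invariantStates H X := by
  refine ⟨hΛ, fun g k k' hk => ?_⟩
  have hm : MeasurePreserving (fun x : X => g • x) μ μ := measurePreserving_smul g μ
  rw [hμ, hμ]
  simp_rw [hk]
  exact hm.integral_comp (Homeomorph.smul g).measurableEmbedding k

open ProbabilityTheory in
theorem smulInvariant_cond {H Y : Type*} [MeasurableSpace Y] [Group H] [MulAction H Y]
    [MeasurableConstSMul H Y] {μ : Measure Y} [SMulInvariantMeasure H Y μ] {s : Set Y}
    (hs : MeasurableSet s) (h : ∀ g : H, (g • ·) ⁻¹' s =ᵐ[μ] s) :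
    SMulInvariantMeasure H Y μ[|s] := by
  refine ⟨fun g t ht => ?_⟩
  rw [cond_apply hs, cond_apply hs]
  congr 1
  calc μ (s ∩ (g • ·) ⁻¹' t) = μ ((g • ·) ⁻¹' (s ∩ t)) :=
        measure_congr ((h g).symm.inter (ae_eq_refl _))
    _ = μ (s ∩ t) := measure_preimage_smul_of_nullMeasurableSet (hs.inter ht).nullMeasurableSet g

open ProbabilityTheory in
-- If an almost invariant set and its complement both had positive mass, the two conditional
-- measures would be invariant and would exhibit the state as a proper convex combination.
theorem ergodicSMul_of_mem_extremePoints {Λ : WeakDual ℝ C(X, ℝ)}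
    (hΛ : Λ ∈ (invariantStates H X).extremePoints ℝ) {μ : Measure X} [IsProbabilityMeasure μ]
    (hμ : ∀ k : C(X, ℝ), ∫ x, k x ∂μ = Λ k) : ErgodicSMul H X μ := by
  have hinv : SMulInvariantMeasure H X μ := smulInvariant_of_state hΛ.1 hμ
  refine ⟨fun {s} hs h => ?_⟩
  by_contra hcon
  obtain ⟨h1, h2⟩ : μ s ≠ 0 ∧ μ sᶜ ≠ 0 := by
    simpa [eventuallyConst_set, ae_iff, and_comm] using! hcon
  have hc : ∀ g : H, (g • ·) ⁻¹' sᶜ =ᵐ[μ] sᶜ := fun g => by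
    rw [Set.preimage_compl]; exact (h g).compl
  have i1 := smulInvariant_cond hs h
  have i2 := smulInvariant_cond hs.compl hc
  have p1 : IsProbabilityMeasure μ[|s] := cond_isProbabilityMeasure h1
  have p2 : IsProbabilityMeasure μ[|sᶜ] := cond_isProbabilityMeasure h2
  obtain ⟨Λ₁, hs₁, hΛ₁⟩ := exists_state_of_measure μ[|s]
  obtain ⟨Λ₂, hs₂, hΛ₂⟩ := exists_state_of_measure μ[|sᶜ]
  have key : ∀ t : Set X, μ t ≠ 0 → ∀ k : C(X, ℝ),
      μ.real t * ∫ x, k x ∂μ[|t] = ∫ x in t, k x ∂μ := fun t ht k => by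
    rw [ProbabilityTheory.cond, integral_smul_measure, smul_eq_mul, ENNReal.toReal_inv, ← mul_assoc,
      Measure.real, mul_inv_cancel₀ (ENNReal.toReal_ne_zero.2 ⟨ht, measure_ne_top _ _⟩), one_mul]
  have hseg : Λ ∈ openSegment ℝ Λ₁ Λ₂ := by
    refine ⟨μ.real s, μ.real sᶜ, ENNReal.toReal_pos h1 (measure_ne_top _ _),
      ENNReal.toReal_pos h2 (measure_ne_top _ _), by simp [measureReal_compl hs], ?_⟩
    refine DFunLike.ext _ _ fun k => ?_
    change μ.real s * Λ₁ k + μ.real sᶜ * Λ₂ k = Λ k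
    rw [hΛ₁, hΛ₂, key s h1, key _ h2, ← hμ, integral_add_compl hs (k.integrable_of_compactSpace μ)]
  -- Extremality forces conditioning on `s` to leave `μ` unchanged, although it gives `sᶜ` mass
  -- zero.
  have heq := hΛ.2 (state_mem_invariantStates hs₁ hΛ₁) (state_mem_invariantStates hs₂ hΛ₂) hseg
  have : μ[|s] = μ := measure_eq_of_integral_continuousMap fun k => by rw [← hΛ₁, heq, hμ]
  rw [← this] at h2
  simp [cond_apply hs] at h2

/-- Evaluation at `ξ` is weak-* continuous and linear, so its maximisers form a nonempty compact
exposed face. Krein–Milman gives that face an extreme point, which is extreme among all invariant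
states. -/
theorem exists_ergodic_le {Λ₀ : WeakDual ℝ C(X, ℝ)} (h₀ : Λ₀ ∈ invariantStates H X)
    (ξ : C(X, ℝ)) :
    ∃ ν : Measure X, IsProbabilityMeasure ν ∧ ErgodicSMul H X ν ∧ Λ₀ ξ ≤ ∫ x, ξ x ∂ν := by
  have hK : IsCompact (invariantStates H X) :=
    stateSpace_isCompact.of_isClosed_subset invariantStates_isClosed fun Λ h => h.1
  let e : StrongDual ℝ (WeakDual ℝ C(X, ℝ)) :=
    { toFun := fun Λ => Λ ξ
      map_add' := fun _ _ => rfl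
      map_smul' := fun _ _ => rfl
      cont := WeakDual.eval_continuous ξ }
  have hex : IsExposed ℝ (invariantStates H X) (e.toExposed (invariantStates H X)) :=
    ContinuousLinearMap.toExposed.isExposed
  obtain ⟨Λ', hΛ', hmax⟩ := hK.exists_isMaxOn ⟨Λ₀, h₀⟩ e.continuous.continuousOn
  have : LocallyConvexSpace ℝ (WeakDual ℝ C(X, ℝ)) :=
    inferInstanceAs (LocallyConvexSpace ℝ (WeakBilin _))
  obtain ⟨Λ, hΛ⟩ := (hex.isCompact hK).extremePoints_nonempty ⟨Λ', hΛ', fun y hy => hmax hy⟩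
  have hle : Λ₀ ξ ≤ Λ ξ := hΛ.1.2 Λ₀ h₀
  have hext := hex.isExtreme.extremePoints_subset_extremePoints hΛ
  obtain ⟨ν, hν, hνk⟩ := exists_measure_of_state hext.1.1
  exact ⟨ν, hν, ergodicSMul_of_mem_extremePoints hext hνk, (hνk ξ).symm ▸ hle⟩

end States

/-! ### The compact metrizable model of a bi-uniformly continuous function -/

section Model

variable {G : Type u} [TopologicalSpace G] [Group G] [IsTopologicalGroup G]

/-- The function `(g, h) ↦ f (g x h⁻¹)`. -/
def orbitFun (f : G → ℝ) (x : G) : G × G → ℝ := fun p => f (p.1 * x * p.2⁻¹)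

/-- The closure of the functions `orbitFun f x` for the topology of pointwise convergence. -/
def OrbitModel (f : G → ℝ) : Type u := closure (Set.range (orbitFun f))

/-- Uniform continuity of `f` for the two-sided translation action of `G × G`. -/
def IsBiUniform (f : G → ℝ) : Prop :=
  ∀ ε > 0, ∀ᶠ p : G × G in 𝓝 1, ∀ x, |f (p.1 * x * p.2⁻¹) - f x| < ε

variable {f : G → ℝ}

instance : TopologicalSpace (OrbitModel f) :=
  inferInstanceAs (TopologicalSpace (closure (Set.range (orbitFun f))))

theorem IsBiUniform.continuous (hf : IsBiUniform f) : Continuous f := by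
  refine continuous_iff_continuousAt.2 fun x => Metric.tendsto_nhds.2 fun ε hε => ?_
  have ht : Tendsto (fun y : G => (y * x⁻¹, (1 : G))) (𝓝 x) (𝓝 1) := by
    have : Continuous fun y : G => (y * x⁻¹, (1 : G)) := by fun_prop
    simpa using! this.tendsto x
  filter_upwards [ht.eventually (hf ε hε)] with y hy
  simpa [Real.dist_eq] using hy x

/-- Bi-uniformity makes all orbit functions equicontinuous at `p`. The non-strict inequality is a
closed condition, so it passes to pointwise limits. -/
theorem IsBiUniform.eventually_orbitFun (hf : IsBiUniform f) (p : G × G) {ε : ℝ} (hε : 0 < ε) :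
    ∀ᶠ q in 𝓝 p, ∀ F ∈ closure (Set.range (orbitFun f)), |F q - F p| ≤ ε := by
  have ht : Tendsto (fun q : G × G => q * p⁻¹) (𝓝 p) (𝓝 1) := by
    have : Continuous fun q : G × G => q * p⁻¹ := by fun_prop
    simpa using! this.tendsto p
  filter_upwards [ht.eventually (hf ε hε)] with q hq F hF
  have hcl : IsClosed {F : G × G → ℝ | |F q - F p| ≤ ε} :=
    isClosed_le (by fun_prop) continuous_const
  refine closure_minimal ?_ hcl hF
  rintro _ ⟨x, rfl⟩
  have := hq (p.1 * x * p.2⁻¹)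
  simp only [Prod.fst_mul, Prod.snd_mul, Prod.fst_inv, Prod.snd_inv] at this
  have e : q.1 * p.1⁻¹ * (p.1 * x * p.2⁻¹) * (q.2 * p.2⁻¹)⁻¹ = q.1 * x * q.2⁻¹ := by group
  rw [e] at this
  exact this.le

theorem IsBiUniform.continuous_coe (hf : IsBiUniform f) (F : OrbitModel f) : Continuous F.1 :=
  continuous_iff_continuousAt.2 fun p => Metric.tendsto_nhds.2 fun ε hε => by
    filter_upwards [hf.eventually_orbitFun p (half_pos hε)] with q hq
    exact (hq F.1 F.2).trans_lt (half_lt_self hε)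

theorem OrbitModel.compactSpace {G : Type*} [Group G] {f : G → ℝ} {C : ℝ} (hC : ∀ x, |f x| ≤ C) :
    CompactSpace (OrbitModel f) := by
  refine isCompact_iff_compactSpace.1 ?_
  refine (isCompact_univ_pi fun _ : G × G => isCompact_Icc (a := -C) (b := C)).of_isClosed_subset
    isClosed_closure (closure_minimal ?_ (isClosed_set_pi fun _ _ => isClosed_Icc))
  rintro _ ⟨x, rfl⟩ p -
  exact abs_le.1 (hC _)

/-- Points of the model are continuous functions, hence determined on a countable dense set. By
compactness, restriction to that set embeds the model in a countable power of the line. -/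
theorem IsBiUniform.metrizableSpace [SecondCountableTopology G] (hf : IsBiUniform f)
    [CompactSpace (OrbitModel f)] : TopologicalSpace.MetrizableSpace (OrbitModel f) := by
  obtain ⟨D, hD, hDd⟩ := TopologicalSpace.exists_countable_dense (G × G)
  have : Countable D := hD
  let r : OrbitModel f → D → ℝ := fun F d => F.1 d
  have hr : Continuous r := continuous_pi fun d => (continuous_apply d.1).comp continuous_subtype_val
  have hinj : Function.Injective r := fun F F' h => Subtype.ext <|
    Continuous.ext_on hDd (hf.continuous_coe F) (hf.continuous_coe F') fun d hd =>
      congrFun h ⟨d, hd⟩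
  exact (hr.isClosedEmbedding hinj).isEmbedding.metrizableSpace

instance : MulAction (G × G) (OrbitModel f) where
  smul a F := ⟨fun p => F.1 (p * a), by
    have hc : Continuous fun F : G × G → ℝ => fun p => F (p * a) := by fun_prop
    refine closure_mono ?_ (image_closure_subset_closure_image hc ⟨F.1, F.2, rfl⟩)
    rintro _ ⟨_, ⟨x, rfl⟩, rfl⟩
    -- Right translation of the argument permutes the orbit functions, hence preserves their
    -- closure.
    refine ⟨a.1 * x * a.2⁻¹, funext fun p => ?_⟩
    simp only [orbitFun, Prod.fst_mul, Prod.snd_mul, mul_inv_rev, mul_assoc]⟩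
  one_smul F := Subtype.ext (funext fun p => congrArg F.1 (mul_one p))
  mul_smul a b F := Subtype.ext (funext fun p => congrArg F.1 (mul_assoc p a b).symm)

/-- Pointwise convergence alone would only give separate continuity; equicontinuity controls the
change of group element uniformly over the model. -/
theorem IsBiUniform.continuousSMul (hf : IsBiUniform f) :
    ContinuousSMul (G × G) (OrbitModel f) := by
  refine ⟨Continuous.subtype_mk (continuous_pi fun p => ?_) _⟩
  refine continuous_iff_continuousAt.2 fun ⟨a, F⟩ => Metric.tendsto_nhds.2 fun ε hε => ?_
  have h1 : Tendsto (fun z : (G × G) × OrbitModel f => p * z.1) (𝓝 (a, F)) (𝓝 (p * a)) := by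
    have : Continuous fun z : (G × G) × OrbitModel f => p * z.1 := by fun_prop
    exact this.tendsto _
  have h2 : Tendsto (fun z : (G × G) × OrbitModel f => z.2.1 (p * a)) (𝓝 (a, F))
      (𝓝 (F.1 (p * a))) := by
    have : Continuous fun z : (G × G) × OrbitModel f => z.2.1 (p * a) :=
      (continuous_apply (p * a)).comp (continuous_subtype_val.comp continuous_snd)
    exact this.tendsto _
  filter_upwards [h1.eventually (hf.eventually_orbitFun (p * a) (half_pos hε)),
    Metric.tendsto_nhds.1 h2 _ (half_pos hε)] with z hz1 hz2
  have h3 := hz1 z.2.1 z.2.2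
  rw [← Real.dist_eq] at h3
  calc _ ≤ dist (z.2.1 (p * z.1)) (z.2.1 (p * a)) + dist (z.2.1 (p * a)) (F.1 (p * a)) :=
        dist_triangle _ _ _
    _ < ε := by linarith

/-- A bounded bi-uniformly continuous function on `G` is the restriction of a continuous function
on a metrizable compactification of `G` to which the two-sided translation action extends. -/
theorem exists_compact_model [SecondCountableTopology G] (hf : IsBiUniform f) {C : ℝ}
    (hC : ∀ x, |f x| ≤ C) :
    ∃ (X : Type u) (_ : MetricSpace X) (_ : CompactSpace X) (_ : MulAction (G × G) X)
      (_ : ContinuousSMul (G × G) X) (ξ : C(X, ℝ)) (ι : C(G, X)),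
      DenseRange ι ∧ (∀ (p : G × G) (x : G), ι (p.1 * x * p.2⁻¹) = p • ι x) ∧
      ∀ x, ξ (ι x) = f x := by
  have hcpt := OrbitModel.compactSpace hC
  have hmet := hf.metrizableSpace
  have hsm := hf.continuousSMul
  let ι : G → OrbitModel f := fun x => ⟨orbitFun f x, subset_closure ⟨x, rfl⟩⟩
  have hι : Continuous ι := Continuous.subtype_mk (continuous_pi fun p =>
    hf.continuous.comp (by fun_prop)) _
  refine ⟨OrbitModel f, TopologicalSpace.metrizableSpaceMetric _, hcpt, inferInstance, hsm,
    ⟨fun F => F.1 1, (continuous_apply _).comp continuous_subtype_val⟩, ⟨ι, hι⟩, ?_, ?_, ?_⟩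
  · rintro ⟨F, hF⟩
    change _ ∈ closure (Set.range ι)
    refine (closure_subtype (x := (⟨F, hF⟩ : closure (Set.range (orbitFun f))))
      (s := Set.range ι)).2 ?_
    rw [← Set.range_comp]
    exact hF
  · intro p x
    refine Subtype.ext (funext fun q => ?_)
    change f _ = f _
    simp only [Prod.fst_mul, Prod.snd_mul, mul_inv_rev, mul_assoc]
  · intro x
    change f _ = f x
    simp

end Model

/-! ### Integrals of bounded functions against densities -/

section Integrals

variable {Y : Type*} [MeasurableSpace Y] {m : Measure Y}

theorem abs_integral_mul_le {C : ℝ} {k a : Y → ℝ} (hC : ∀ x, |k x| ≤ C) (ha : Integrable a m) :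
    |∫ x, k x * a x ∂m| ≤ C * ∫ x, |a x| ∂m := by
  rw [← integral_const_mul, ← Real.norm_eq_abs]
  refine norm_integral_le_of_norm_le (ha.abs.const_mul C) (Eventually.of_forall fun x => ?_)
  rw [norm_mul, Real.norm_eq_abs, Real.norm_eq_abs]
  exact mul_le_mul_of_nonneg_right (hC x) (abs_nonneg _)

theorem integrable_bounded_mul {C : ℝ} {k a : Y → ℝ} (hk : Measurable k) (hC : ∀ x, |k x| ≤ C)
    (ha : Integrable a m) : Integrable (fun x => k x * a x) m :=
  ha.bdd_mul hk.aestronglyMeasurable (Eventually.of_forall hC)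

theorem abs_integral_mul_sub_le {C : ℝ} {k a b : Y → ℝ} (hk : Measurable k)
    (hC : ∀ x, |k x| ≤ C) (ha : Integrable a m) (hb : Integrable b m) :
    |∫ x, k x * a x ∂m - ∫ x, k x * b x ∂m| ≤ C * ∫ x, |a x - b x| ∂m := by
  rw [← integral_sub (integrable_bounded_mul hk hC ha) (integrable_bounded_mul hk hC hb)]
  simp_rw [← mul_sub]
  exact abs_integral_mul_le hC (ha.sub hb)

theorem integral_abs_convexCombination_le {α β : Y → ℝ} (hα : Integrable α m)
    (hβ : Integrable β m) {s t c : ℝ} (hs : 0 ≤ s) (ht : 0 ≤ t) (hst : s + t = 1)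
    (h1 : ∫ x, |α x| ∂m ≤ c) (h2 : ∫ x, |β x| ∂m ≤ c) : ∫ x, |s * α x + t * β x| ∂m ≤ c := by
  calc ∫ x, |s * α x + t * β x| ∂m ≤ ∫ x, (s * |α x| + t * |β x|) ∂m := by
        refine integral_mono ((hα.const_mul s).add (hβ.const_mul t)).abs
          ((hα.abs.const_mul s).add (hβ.abs.const_mul t)) fun x => (abs_add_le _ _).trans_eq ?_
        rw [abs_mul, abs_mul, abs_of_nonneg hs, abs_of_nonneg ht]
    _ = s * ∫ x, |α x| ∂m + t * ∫ x, |β x| ∂m := by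
        rw [integral_add (hα.abs.const_mul s) (hβ.abs.const_mul t), integral_const_mul,
          integral_const_mul]
    _ ≤ s * c + t * c := by gcongr
    _ = c := by rw [← add_mul, hst, one_mul]

theorem integral_abs_eq_one {φ : Y → ℝ} (hφ : 0 ≤ᵐ[m] φ) (h1 : ∫ x, φ x ∂m = 1) :
    ∫ x, |φ x| ∂m = 1 := by
  rw [← h1]
  refine integral_congr_ae ?_
  filter_upwards [hφ] with x hx using abs_of_nonneg hx

end Integrals

/-! ### Translation defects, convolution and approximation of invariant measures -/

section Reiter

variable {G : Type*} [TopologicalSpace G] [Group G] [IsTopologicalGroup G]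
  [LocallyCompactSpace G] [SecondCountableTopology G] [MeasurableSpace G] [BorelSpace G]
  {m : Measure G} [m.IsHaarMeasure]

theorem map_mul_right_eq_smul_haar (g : G) :
    Measure.map (· * g) m = (Measure.modularCharacter g : NNReal) • m :=
  Measure.map_right_mul_eq_modularCharacterFun_smul m g

theorem integrable_comp_mul_right_haar {f : G → ℝ} (hf : Integrable f m) (g : G) :
    Integrable (fun x => f (x * g)) m := by
  have h : Integrable f (Measure.map (· * g) m) := by
    rw [map_mul_right_eq_smul_haar g]
    exact hf.smul_measure_nnreal
  exact (integrable_map_equiv (MeasurableEquiv.mulRight g) f).1 h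

theorem modularFn_mul_integral_comp_mul_right (f : G → ℝ) (g : G) :
    modularFn g * ∫ x, f (x * g) ∂m = ∫ x, f x ∂m := by
  have h2 : ∫ x, f (x * g) ∂m = ∫ x, f x ∂(Measure.map (· * g) m) :=
    ((MeasurableEquiv.mulRight g).measurableEmbedding.integral_map f).symm
  have h3 : ((Measure.modularCharacter g : NNReal) : ℝ) ≠ 0 := by
    have := Measure.modularCharacterFun_pos g
    exact_mod_cast this.ne'
  rw [h2, map_mul_right_eq_smul_haar, integral_smul_nnreal_measure, modularFn, NNReal.smul_def,
    smul_eq_mul, inv_mul_cancel_left₀ h3]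

/-- The `L¹`-distance of `φ` to its left translate by `g`. -/
noncomputable def leftDefect (m : Measure G) (φ : G → ℝ) (g : G) : ℝ :=
  ∫ x, |φ (g⁻¹ * x) - φ x| ∂m

/-- The `L¹`-distance of `φ` to its normalised right translate by `g`. -/
noncomputable def rightDefect (m : Measure G) (φ : G → ℝ) (g : G) : ℝ :=
  ∫ x, |modularFn g * φ (x * g) - φ x| ∂m

/-- Changes of variables move the translations from `k` to `φ`, one side at a time; the right one
contributes the modular factor. -/
theorem abs_integral_translate_sub_le {C : ℝ} {k φ : G → ℝ} (hk : Measurable k)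
    (hC : ∀ x, |k x| ≤ C) (hφ : Integrable φ m) (p : G × G) :
    |∫ x, k (p.1 * x * p.2⁻¹) * φ x ∂m - ∫ x, k x * φ x ∂m| ≤
      C * (leftDefect m φ p.1 + rightDefect m φ p.2) := by
  have h1 : ∫ x, k (p.1 * x * p.2⁻¹) * φ x ∂m = ∫ x, k (x * p.2⁻¹) * φ (p.1⁻¹ * x) ∂m := by
    rw [← integral_mul_left_eq_self (fun x => k (x * p.2⁻¹) * φ (p.1⁻¹ * x)) p.1]
    simp
  have h2 : ∫ x, k (x * p.2⁻¹) * φ x ∂m = ∫ x, k x * (modularFn p.2 * φ (x * p.2)) ∂m := by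
    rw [← modularFn_mul_integral_comp_mul_right _ p.2, ← integral_const_mul]
    refine integral_congr_ae (Eventually.of_forall fun x => ?_)
    simp only [mul_inv_cancel_right]
    ring
  have l := abs_integral_mul_sub_le (k := fun x => k (x * p.2⁻¹)) (hk.comp (measurable_mul_const _))
    (fun x => hC _) (hφ.comp_mul_left p.1⁻¹) hφ
  have r := abs_integral_mul_sub_le hk hC
    ((integrable_comp_mul_right_haar hφ p.2).const_mul (modularFn p.2)) hφ
  rw [← h1] at l
  rw [← h2] at r
  rw [mul_add]
  exact (abs_sub_le _ _ _).trans (add_le_add l r)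

theorem IsTwoSidedReiter.tendsto_translate {Φ : ℕ → G → ℝ} (hΦ : IsTwoSidedReiter m Φ) {C : ℝ}
    {k : G → ℝ} (hk : Measurable k) (hC : ∀ x, |k x| ≤ C) (p : G × G) :
    Tendsto (fun N => ∫ x, k (p.1 * x * p.2⁻¹) * Φ N x ∂m - ∫ x, k x * Φ N x ∂m) atTop (𝓝 0) := by
  refine squeeze_zero_norm (fun N => abs_integral_translate_sub_le hk hC (hΦ.integrable N) p) ?_
  have := ((hΦ.left p.1).add (hΦ.right p.2)).const_mul C
  simpa [leftDefect, rightDefect] using! this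

/-- The convolution of two functions on a group. -/
noncomputable def mulConv (m : Measure G) (φ H : G → ℝ) (y : G) : ℝ :=
  ∫ a, φ a * H (a⁻¹ * y) ∂m

variable {φ H : G → ℝ}

theorem integrable_mulConv_integrand (hφ : Integrable φ m) (hH : Integrable H m) :
    Integrable (fun p : G × G => φ p.1 * H (p.1⁻¹ * p.2)) (m.prod m) :=
  (measurePreserving_prod_inv_mul m m).integrable_comp_of_integrable (hφ.mul_prod hH)

theorem integrable_mulConv (hφ : Integrable φ m) (hH : Integrable H m) :
    Integrable (mulConv m φ H) m :=
  (integrable_mulConv_integrand hφ hH).integral_prod_right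

theorem integral_mul_mulConv {k : G → ℝ} {C : ℝ} (hk : Measurable k) (hC : ∀ x, |k x| ≤ C)
    (hφ : Integrable φ m) (hH : Integrable H m) :
    ∫ y, k y * mulConv m φ H y ∂m =
      ∫ p : G × G, k (p.1 * p.2) * (φ p.1 * H p.2) ∂(m.prod m) := by
  have hi : Integrable (fun p : G × G => k p.2 * (φ p.1 * H (p.1⁻¹ * p.2))) (m.prod m) :=
    (integrable_mulConv_integrand hφ hH).bdd_mul
      (hk.comp measurable_snd).aestronglyMeasurable (Eventually.of_forall fun p => hC p.2)
  have hemb : MeasurableEmbedding (fun z : G × G => (z.1, z.1⁻¹ * z.2)) :=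
    (MeasurableEquiv.shearMulRight G).symm.measurableEmbedding
  rw [← (measurePreserving_prod_inv_mul m m).integral_comp hemb]
  simp only [mul_inv_cancel_left]
  rw [integral_prod_symm _ hi]
  simp_rw [integral_const_mul]
  rfl

theorem integral_mulConv (hφ : Integrable φ m) (hH : Integrable H m) :
    ∫ y, mulConv m φ H y ∂m = (∫ x, φ x ∂m) * ∫ x, H x ∂m := by
  have := integral_mul_mulConv (k := fun _ => (1 : ℝ)) (C := 1) measurable_const (by simp) hφ hH
  simpa [integral_prod_mul] using this

theorem integral_abs_mulConv_le (hφ : Integrable φ m) (hH : Integrable H m) :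
    ∫ y, |mulConv m φ H y| ∂m ≤ (∫ x, |φ x| ∂m) * ∫ x, |H x| ∂m := by
  rw [← integral_mulConv hφ.abs hH.abs]
  refine integral_mono (integrable_mulConv hφ hH).abs (integrable_mulConv hφ.abs hH.abs) fun y => ?_
  refine (abs_integral_le_integral_abs).trans_eq ?_
  simp_rw [abs_mul]
  rfl

/-- Left translation of a convolution acts on the left factor alone. -/
theorem leftDefect_mulConv_le (hφ : Integrable φ m) (hH : Integrable H m) (g : G) :
    leftDefect m (mulConv m φ H) g ≤ leftDefect m φ g * ∫ x, |H x| ∂m := by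
  have hφ' := hφ.comp_mul_left g⁻¹
  refine le_of_eq_of_le (integral_congr_ae ?_) (integral_abs_mulConv_le (hφ'.sub hφ) hH)
  -- Fubini makes the integrands integrable only for almost every `y`, so the integral of the
  -- difference splits only almost everywhere.
  filter_upwards [(integrable_mulConv_integrand hφ hH).prod_left_ae,
    (integrable_mulConv_integrand hφ' hH).prod_left_ae] with y h1 h2
  have h3 : mulConv m φ H (g⁻¹ * y) = mulConv m (fun x => φ (g⁻¹ * x)) H y := by
    unfold mulConv
    rw [← integral_mul_left_eq_self (fun a => φ (g⁻¹ * a) * H (a⁻¹ * y)) g]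
    simp [mul_assoc]
  rw [h3]
  simp only [mulConv, sub_mul]
  rw [integral_sub h2 h1]

theorem rightDefect_mulConv_le (hφ : Integrable φ m) (hH : Integrable H m) (g : G) :
    rightDefect m (mulConv m φ H) g ≤ (∫ x, |φ x| ∂m) * rightDefect m H g := by
  have hH' := (integrable_comp_mul_right_haar hH g).const_mul (modularFn g)
  refine le_of_eq_of_le (integral_congr_ae ?_) (integral_abs_mulConv_le hφ (hH'.sub hH))
  filter_upwards [(integrable_mulConv_integrand hφ hH).prod_left_ae,
    (integrable_mulConv_integrand hφ hH').prod_left_ae] with y h1 h2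
  have h3 : modularFn g * mulConv m φ H (y * g) =
      mulConv m φ (fun x => modularFn g * H (x * g)) y := by
    unfold mulConv
    rw [← integral_const_mul]
    refine integral_congr_ae (Eventually.of_forall fun a => ?_)
    simp only [mul_assoc]
    ring
  rw [h3]
  simp only [mulConv, mul_sub]
  rw [integral_sub h2 h1]

theorem rightDefect_comp_mul_left (φ : G → ℝ) (x g : G) :
    rightDefect m (fun y => φ (x⁻¹ * y)) g = rightDefect m φ g := by
  unfold rightDefect
  rw [← integral_mul_left_eq_self (fun y => |modularFn g * φ (y * g) - φ y|) x⁻¹]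
  simp only [mul_assoc]

/-- The probability densities whose translation defects are bounded by `l` and `r`. -/
def reiterSet (m : Measure G) (l r : G → ℝ) : Set (G → ℝ) :=
  {Ψ | Integrable Ψ m ∧ 0 ≤ᵐ[m] Ψ ∧ ∫ x, Ψ x ∂m = 1 ∧ (∀ g, leftDefect m Ψ g ≤ l g) ∧
    ∀ g, rightDefect m Ψ g ≤ r g}

theorem convex_reiterSet (l r : G → ℝ) : Convex ℝ (reiterSet m l r) := by
  rintro α ⟨ha1, ha2, ha3, ha4, ha5⟩ β ⟨hb1, hb2, hb3, hb4, hb5⟩ s t hs ht hst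
  refine ⟨(ha1.smul s).add (hb1.smul t), ?_, ?_, fun g => ?_, fun g => ?_⟩
  · filter_upwards [ha2, hb2] with x h1 h2
    exact add_nonneg (mul_nonneg hs h1) (mul_nonneg ht h2)
  · change ∫ x, (s * α x + t * β x) ∂m = 1
    rw [integral_add (ha1.const_mul s) (hb1.const_mul t), integral_const_mul, integral_const_mul,
      ha3, hb3, mul_one, mul_one, hst]
  · refine le_of_eq_of_le (integral_congr_ae (Eventually.of_forall fun x => ?_))
      (integral_abs_convexCombination_le ((ha1.comp_mul_left g⁻¹).sub ha1)
        ((hb1.comp_mul_left g⁻¹).sub hb1) hs ht hst (ha4 g) (hb4 g))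
    simp only [Pi.add_apply, Pi.smul_apply, Pi.sub_apply, smul_eq_mul]
    congr 1; ring
  · refine le_of_eq_of_le (integral_congr_ae (Eventually.of_forall fun x => ?_))
      (integral_abs_convexCombination_le
        (((integrable_comp_mul_right_haar ha1 g).const_mul (modularFn g)).sub ha1)
        (((integrable_comp_mul_right_haar hb1 g).const_mul (modularFn g)).sub hb1)
        hs ht hst (ha5 g) (hb5 g))
    simp only [Pi.add_apply, Pi.smul_apply, Pi.sub_apply, smul_eq_mul]
    congr 1; ring

/-- The left factor controls the left defect and the right factor the right defect. Left translation
by `x` commutes with right translation, so the bounds do not depend on `x`. -/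
theorem mulConv_mem_reiterSet (hi : Integrable φ m) (hφ : 0 ≤ᵐ[m] φ) (h1 : ∫ x, φ x ∂m = 1)
    (x : G) : mulConv m φ (fun y => φ (x⁻¹ * y)) ∈ reiterSet m (leftDefect m φ) (rightDefect m φ) := by
  have hi' := hi.comp_mul_left x⁻¹
  have h1' : ∫ y, φ (x⁻¹ * y) ∂m = 1 := by rw [integral_mul_left_eq_self φ x⁻¹, h1]
  have ha' : ∫ y, |φ (x⁻¹ * y)| ∂m = 1 := by
    rw [integral_mul_left_eq_self (fun y => |φ y|) x⁻¹, integral_abs_eq_one hφ h1]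
  have hq : ∀ y, 0 ≤ᵐ[m] fun a => φ (x⁻¹ * (a⁻¹ * y)) := fun y => by
    -- Nonnegativity of `φ` is known only almost everywhere. Inversion and right translation need
    -- not preserve `m`, but they preserve its null sets, which suffices.
    have hqmp : Measure.QuasiMeasurePreserving (fun a : G => x⁻¹ * (a⁻¹ * y)) m m :=
      (measurePreserving_mul_left m x⁻¹).quasiMeasurePreserving.comp
        ((quasiMeasurePreserving_mul_right m y).comp (quasiMeasurePreserving_inv m))
    exact hqmp.ae hφ
  refine ⟨integrable_mulConv hi hi', Eventually.of_forall fun y => ?_, ?_, fun g => ?_, fun g => ?_⟩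
  · refine integral_nonneg_of_ae ?_
    filter_upwards [hφ, hq y] with a h2 h3 using mul_nonneg h2 h3
  · rw [integral_mulConv hi hi', h1, h1', one_mul]
  · simpa [ha'] using leftDefect_mulConv_le hi hi' g
  · simpa [integral_abs_eq_one hφ h1, rightDefect_comp_mul_left] using
      rightDefect_mulConv_le hi hi' g

variable {X : Type*} [MetricSpace X] [CompactSpace X] [MeasurableSpace X] [BorelSpace X]
  [MulAction (G × G) X] [ContinuousSMul (G × G) X]

/-- The average of `k` over the orbit of `z`, both factors of `G × G` being weighted by `φ`. -/
noncomputable def orbitAverage (m : Measure G) (φ : G → ℝ) (k : C(X, ℝ)) (z : X) : ℝ :=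
  ∫ p : G × G, k ((p.1, p.2⁻¹) • z) * (φ p.1 * φ p.2) ∂(m.prod m)

theorem continuous_orbitAverage (hi : Integrable φ m) (k : C(X, ℝ)) :
    Continuous (orbitAverage m φ k) := by
  have hp : Integrable (fun p : G × G => φ p.1 * φ p.2) (m.prod m) := hi.mul_prod hi
  refine continuous_of_dominated (bound := fun p => ‖k‖ * ‖φ p.1 * φ p.2‖) (fun z => ?_)
    (fun z => Eventually.of_forall fun p => ?_) (hp.norm.const_mul _)
    (Eventually.of_forall fun p => ?_)
  · have : Continuous fun p : G × G => k ((p.1, p.2⁻¹) • z) := by fun_prop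
    exact this.aestronglyMeasurable.mul hp.aestronglyMeasurable
  · rw [norm_mul]
    exact mul_le_mul_of_nonneg_right (k.norm_coe_le_norm _) (norm_nonneg _)
  · fun_prop

theorem integral_orbitAverage (hi : Integrable φ m) (h1 : ∫ x, φ x ∂m = 1) (k : C(X, ℝ))
    (ν : Measure X) [IsProbabilityMeasure ν] [SMulInvariantMeasure (G × G) X ν] :
    ∫ z, orbitAverage m φ k z ∂ν = ∫ z, k z ∂ν := by
  have hp : Integrable (fun p : G × G => φ p.1 * φ p.2) (m.prod m) := hi.mul_prod hi
  have hc : Continuous fun z : X × (G × G) => k ((z.2.1, z.2.2⁻¹) • z.1) := by fun_prop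
  have hint : Integrable (fun z : X × (G × G) =>
      k ((z.2.1, z.2.2⁻¹) • z.1) * (φ z.2.1 * φ z.2.2)) (ν.prod (m.prod m)) :=
    (hp.comp_snd ν).bdd_mul hc.aestronglyMeasurable
      (Eventually.of_forall fun z => k.norm_coe_le_norm _)
  have hinv : ∀ p : G × G, ∫ z, k (p • z) ∂ν = ∫ z, k z ∂ν := fun p =>
    (measurePreserving_smul p ν).integral_comp (Homeomorph.smul p).measurableEmbedding k
  unfold orbitAverage
  rw [integral_integral_swap hint]
  simp_rw [integral_mul_const, hinv, integral_const_mul]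
  rw [integral_prod_mul, h1, one_mul, mul_one]

/-- Both sides are the mean of `k (ι (a * x * b))` with `a` and `b` weighted by `φ`. The inverse in
`orbitAverage` cancels the one in the action. -/
theorem orbitAverage_apply_dense (hi : Integrable φ m) (k : C(X, ℝ)) {ι : C(G, X)}
    (hι : ∀ (p : G × G) (x : G), ι (p.1 * x * p.2⁻¹) = p • ι x) (x : G) :
    orbitAverage m φ k (ι x) = ∫ y, k (ι y) * mulConv m φ (fun y => φ (x⁻¹ * y)) y ∂m := by
  rw [integral_mul_mulConv (k := fun y => k (ι y)) (k.continuous.comp ι.continuous).measurable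
    (fun y => k.norm_coe_le_norm _) hi (hi.comp_mul_left x⁻¹)]
  have hmp : MeasurePreserving (Prod.map id (x * ·)) (m.prod m) (m.prod m) :=
    (MeasurePreserving.id m).prod (measurePreserving_mul_left m x)
  have hemb : MeasurableEmbedding (Prod.map id (x * ·) : G × G → G × G) :=
    ((MeasurableEquiv.refl G).prodCongr (MeasurableEquiv.mulLeft x)).measurableEmbedding
  rw [← hmp.integral_comp hemb]
  refine integral_congr_ae (Eventually.of_forall fun p => ?_)
  simp only [← hι, Prod.map_fst, Prod.map_snd, id, inv_inv, inv_mul_cancel_left, mul_assoc]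

/-- For finitely many test functions, the vectors of integrals against admissible densities form a
convex set. Its closure contains the orbit averages at points of `ι`, hence by continuity those at
every point of `X`, hence their mean under `ν`. -/
theorem exists_mem_reiterSet_approx (hi : Integrable φ m) (hφ : 0 ≤ᵐ[m] φ)
    (h1 : ∫ x, φ x ∂m = 1) {ι : C(G, X)} (hd : DenseRange ι)
    (hι : ∀ (p : G × G) (x : G), ι (p.1 * x * p.2⁻¹) = p • ι x)
    (ν : Measure X) [IsProbabilityMeasure ν] [SMulInvariantMeasure (G × G) X ν]
    {n : ℕ} (k : Fin n → C(X, ℝ)) {ε : ℝ} (hε : 0 < ε) :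
    ∃ Ψ ∈ reiterSet m (leftDefect m φ) (rightDefect m φ),
      ∀ i, |∫ y, k i (ι y) * Ψ y ∂m - ∫ z, k i z ∂ν| < ε := by
  let T : (G → ℝ) → Fin n → ℝ := fun Ψ i => ∫ y, k i (ι y) * Ψ y ∂m
  let A := reiterSet m (leftDefect m φ) (rightDefect m φ)
  have hkι : ∀ i {Ψ : G → ℝ}, Integrable Ψ m → Integrable (fun y => k i (ι y) * Ψ y) m :=
    fun i _ hΨ => integrable_bounded_mul ((k i).continuous.comp ι.continuous).measurable
      (fun y => (k i).norm_coe_le_norm _) hΨ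
  have hconv : Convex ℝ (T '' A) := by
    rintro _ ⟨α, hα, rfl⟩ _ ⟨β, hβ, rfl⟩ s t hs ht hst
    refine ⟨s • α + t • β, convex_reiterSet _ _ hα hβ hs ht hst, funext fun i => ?_⟩
    simp only [T, Pi.add_apply, Pi.smul_apply, smul_eq_mul]
    rw [← integral_const_mul, ← integral_const_mul,
      ← integral_add ((hkι i hα.1).const_mul s) ((hkι i hβ.1).const_mul t)]
    refine integral_congr_ae (Eventually.of_forall fun y => ?_)
    ring
  let F : X → Fin n → ℝ := fun z i => orbitAverage m φ (k i) z
  have hF : Continuous F := continuous_pi fun i => continuous_orbitAverage hi (k i)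
  have hmem : ∀ z, F z ∈ closure (T '' A) := fun z =>
    hd.induction_on z (isClosed_closure.preimage hF) fun x => subset_closure
      ⟨_, mulConv_mem_reiterSet hi hφ h1 x, funext fun i =>
        (orbitAverage_apply_dense hi (k i) hι x).symm⟩
  have hFi : Integrable F ν :=
    (BoundedContinuousFunction.mkOfCompact ⟨F, hF⟩).integrable ν
  -- A closed convex set contains the barycentre of any probability measure carried by it.
  have hint := hconv.closure.integral_mem isClosed_closure (Eventually.of_forall hmem) hFi
  obtain ⟨_, ⟨Ψ, hΨ, rfl⟩, hdist⟩ := Metric.mem_closure_iff.1 hint ε hε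
  refine ⟨Ψ, hΨ, fun i => ?_⟩
  have h2 : (∫ z, F z ∂ν) i = ∫ z, k i z ∂ν := by
    rw [eval_integral fun i => (integrable_pi_iff.1 hFi i)]
    exact integral_orbitAverage hi h1 (k i) ν
  have h3 := (dist_le_pi_dist _ _ i).trans_lt hdist
  rw [h2, dist_comm, Real.dist_eq] at h3
  exact h3

end Reiter

/-! ### Smoothing an indicator function by two-sided averaging -/

section Smoothing

variable {G : Type*} [TopologicalSpace G] [Group G] [IsTopologicalGroup G]
  [LocallyCompactSpace G] [SecondCountableTopology G] [MeasurableSpace G] [BorelSpace G]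
  {m : Measure G} [m.IsHaarMeasure]

/-- The average over `p`, distributed according to `P`, of the translates of the indicator
function of `W`. -/
noncomputable def smoothing (P : Measure (G × G)) (W : Set G) (x : G) : ℝ :=
  ∫ p, W.indicator (1 : G → ℝ) (p.1⁻¹ * x * p.2) ∂P

/-- By Fubini the difference is the `P`-average of translation errors. Each tends to 0 by asymptotic
invariance and all are bounded by 2, so dominated convergence applies. -/
theorem IsTwoSidedReiter.tendsto_smoothing {Φ : ℕ → G → ℝ} (hΦ : IsTwoSidedReiter m Φ)
    (P : Measure (G × G)) [IsProbabilityMeasure P] {W : Set G} (hW : MeasurableSet W) :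
    Tendsto (fun N => ∫ x, smoothing P W x * Φ N x ∂m - ∫ x in W, Φ N x ∂m) atTop (𝓝 0) := by
  set k : G → ℝ := W.indicator 1 with hk
  have hkm : Measurable k := measurable_one.indicator hW
  have hk1 : ∀ x, |k x| ≤ 1 := fun x => by
    by_cases hx : x ∈ W <;> simp [hk, hx]
  let D : ℕ → G × G → ℝ := fun N p =>
    ∫ x, k (p.1⁻¹ * x * p.2) * Φ N x ∂m - ∫ x, k x * Φ N x ∂m
  have hint : ∀ N, Integrable (fun z : G × (G × G) => k (z.2.1⁻¹ * z.1 * z.2.2) * Φ N z.1)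
      (m.prod P) := fun N => by
    refine ((hΦ.integrable N).comp_fst P).bdd_mul (c := 1) ?_ (Eventually.of_forall fun z => hk1 _)
    have : Measurable fun z : G × (G × G) => z.2.1⁻¹ * z.1 * z.2.2 := by fun_prop
    exact (hkm.comp this).aestronglyMeasurable
  have hD : ∀ N, ∫ x, smoothing P W x * Φ N x ∂m - ∫ x in W, Φ N x ∂m = ∫ p, D N p ∂P := fun N => by
    simp only [D]
    rw [integral_sub (hint N).integral_prod_right (integrable_const _), integral_const,
      ← integral_integral_swap (hint N), probReal_univ, one_smul]
    simp_rw [integral_mul_const]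
    congr 1
    rw [← integral_indicator hW]
    refine integral_congr_ae (Eventually.of_forall fun x => ?_)
    by_cases hx : x ∈ W <;> simp [hk, hx]
  simp_rw [hD]
  rw [← integral_zero (G × G) ℝ (μ := P)]
  have hb : ∀ N (h : G → ℝ), (∀ x, |h x| ≤ 1) → |∫ x, h x * Φ N x ∂m| ≤ 1 := fun N h hh => by
    simpa [integral_abs_eq_one (hΦ.nonneg N) (hΦ.integral_eq_one N)] using
      abs_integral_mul_le hh (hΦ.integrable N)
  refine tendsto_integral_of_dominated_convergence (fun _ => 2) (fun N => ?_)
    (integrable_const _) (fun N => Eventually.of_forall fun p => ?_)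
    (Eventually.of_forall fun p => ?_)
  · exact (hint N).integral_prod_right.aestronglyMeasurable.sub aestronglyMeasurable_const
  · refine (abs_sub _ _).trans ?_
    linarith [hb N (fun x => k (p.1⁻¹ * x * p.2)) fun x => hk1 _, hb N k hk1]
  · simpa using hΦ.tendsto_translate hkm hk1 (p.1⁻¹, p.2⁻¹)

theorem smoothing_eq_real (P : Measure (G × G)) {W : Set G} (hW : MeasurableSet W) (x : G) :
    smoothing P W x = P.real {p | p.1⁻¹ * x * p.2 ∈ W} := by
  have hm : MeasurableSet {p : G × G | p.1⁻¹ * x * p.2 ∈ W} := by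
    have : Measurable fun p : G × G => p.1⁻¹ * x * p.2 := by fun_prop
    exact this hW
  rw [← integral_indicator_one hm]
  rfl

open ProbabilityTheory

theorem smoothing_cond_eq {W : Set G} (hW : MeasurableSet W) {M : Measure (G × G)}
    {Q : Set (G × G)} (hQ : MeasurableSet Q) (x : G) :
    smoothing M[|Q] W x = (M.real Q)⁻¹ * M.real (Q ∩ {p | p.1⁻¹ * x * p.2 ∈ W}) := by
  rw [smoothing_eq_real _ hW, Measure.real, cond_apply hQ, ENNReal.toReal_mul, ENNReal.toReal_inv]
  rfl

/-- Replacing `x` by its translate under `q` replaces the set of pairs carrying `x` into `W` by its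
`q`-translate. Left invariance shifts `q` onto `Q`, so the variation is controlled by the parts of
`q • Q` and `q⁻¹ • Q` outside `Q`. This bound does not involve `x` and vanishes as `q` tends to 1.
-/
theorem isBiUniform_smoothing [T2Space G] {M : Measure (G × G)} [M.IsHaarMeasure] {W : Set G}
    (hW : MeasurableSet W) {Q : Set (G × G)} (hQ : IsCompact Q) :
    IsBiUniform (smoothing M[|Q] W) := by
  have ht : Tendsto (fun q : G × G => M.real (q • Q \ Q)) (𝓝 1) (𝓝 0) :=
    (ENNReal.tendsto_toReal ENNReal.zero_ne_top).comp
      (tendsto_measure_smul_sdiff_isCompact_isClosed hQ hQ.isClosed)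
  have hinv : Tendsto (fun q : G × G => q⁻¹) (𝓝 1) (𝓝 1) := by
    simpa using (continuous_inv (G := G × G)).tendsto 1
  have hsmul : ∀ (q : G × G) (s : Set (G × G)), M.real (q • s) = M.real s := fun q s =>
    congrArg ENNReal.toReal (measure_smul M q s)
  have hfin : ∀ {s : Set (G × G)} (q : G × G), s ⊆ q • Q → M s ≠ ∞ := fun q hs =>
    ne_top_of_le_ne_top (hQ.smul q).measure_ne_top (measure_mono hs)
  have key : ∀ (q : G × G) (x : G), |smoothing M[|Q] W (q.1 * x * q.2⁻¹) - smoothing M[|Q] W x| ≤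
      (M.real Q)⁻¹ * (M.real (q • Q \ Q) + M.real (q⁻¹ • Q \ Q)) := fun q x => by
    set B : Set (G × G) := {p | p.1⁻¹ * x * p.2 ∈ W} with hB
    have hqB : {p : G × G | p.1⁻¹ * (q.1 * x * q.2⁻¹) * p.2 ∈ W} = q • B := by
      ext p
      simp [hB, Set.mem_smul_set_iff_inv_smul_mem, mul_assoc]
    have h1 : M.real (Q ∩ q • B) = M.real (q⁻¹ • Q ∩ B) := by
      rw [← hsmul q⁻¹ (Q ∩ q • B), Set.smul_set_inter, inv_smul_smul]
    have h2 : M.real (q⁻¹ • Q ∩ B) ≤ M.real (Q ∩ B) + M.real (q⁻¹ • Q \ Q) := by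
      refine (measureReal_mono (s₂ := (Q ∩ B) ∪ (q⁻¹ • Q \ Q)) ?_ ?_).trans
        (measureReal_union_le _ _)
      · intro p hp
        by_cases h : p ∈ Q
        · exact Or.inl ⟨h, hp.2⟩
        · exact Or.inr ⟨hp.1, h⟩
      · exact measure_union_ne_top (hfin 1 (by simp)) (hfin q⁻¹ Set.sdiff_subset)
    have h3 : M.real (Q ∩ B) ≤ M.real (q⁻¹ • Q ∩ B) + M.real (q • Q \ Q) := by
      have h4 : M.real (Q \ q⁻¹ • Q) = M.real (q • Q \ Q) := by
        rw [← hsmul q (Q \ q⁻¹ • Q), Set.smul_set_sdiff, smul_inv_smul]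
      rw [← h4]
      refine (measureReal_mono (s₂ := (q⁻¹ • Q ∩ B) ∪ (Q \ q⁻¹ • Q)) ?_ ?_).trans
        (measureReal_union_le _ _)
      · intro p hp
        by_cases h : p ∈ q⁻¹ • Q
        · exact Or.inl ⟨h, hp.2⟩
        · exact Or.inr ⟨hp.1, h⟩
      · exact measure_union_ne_top (hfin q⁻¹ Set.inter_subset_left)
          (hfin 1 (by simp))
    rw [smoothing_cond_eq hW hQ.measurableSet, smoothing_cond_eq hW hQ.measurableSet, hqB, h1,
      ← mul_sub, abs_mul, abs_of_nonneg (inv_nonneg.2 measureReal_nonneg)]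
    refine mul_le_mul_of_nonneg_left (abs_le.2 ⟨?_, ?_⟩) (inv_nonneg.2 measureReal_nonneg)
    · linarith [measureReal_nonneg (μ := M) (s := q⁻¹ • Q \ Q)]
    · linarith [measureReal_nonneg (μ := M) (s := q • Q \ Q)]
  intro ε hε
  have hlim := (ht.add (ht.comp hinv)).const_mul (M.real Q)⁻¹
  rw [add_zero, mul_zero] at hlim
  filter_upwards [hlim.eventually (gt_mem_nhds hε)] with q hq x
  exact (key q x).trans_lt hq

theorem smoothing_nonneg {G : Type*} [Group G] [MeasurableSpace G] (P : Measure (G × G))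
    (W : Set G) (x : G) : 0 ≤ smoothing P W x :=
  integral_nonneg fun _ => Set.indicator_nonneg (fun _ _ => zero_le_one) _

theorem smoothing_le_one (P : Measure (G × G)) [IsProbabilityMeasure P] {W : Set G}
    (hW : MeasurableSet W) (x : G) : smoothing P W x ≤ 1 := by
  rw [smoothing_eq_real P hW]
  exact measureReal_le_one

theorem smoothing_cond_eq_zero {M : Measure (G × G)} {W : Set G} (hW : MeasurableSet W) {K : Set G}
    (hK : MeasurableSet K) {x : G} (hx : x ∉ K * W * K⁻¹) : smoothing M[|K ×ˢ K] W x = 0 := by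
  have : K ×ˢ K ∩ {p : G × G | p.1⁻¹ * x * p.2 ∈ W} = ∅ := by
    refine Set.eq_empty_of_forall_notMem fun p hp => hx ?_
    refine Set.mem_mul.2 ⟨_, Set.mul_mem_mul hp.1.1 hp.2, p.2⁻¹, Set.inv_mem_inv.2 hp.1.2, ?_⟩
    group
  rw [smoothing_cond_eq hW (hK.prod hK), this, measureReal_empty, mul_zero]

theorem smoothing_cond_singleton_one {M : Measure (G × G)} {W : Set G} (hW : MeasurableSet W)
    (h1 : MeasurableSet ({1} : Set G)) (hM : M.real ({1} ×ˢ {1}) ≠ 0) (x : G) :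
    smoothing M[|{1} ×ˢ {1}] W x = W.indicator 1 x := by
  rw [smoothing_cond_eq hW (h1.prod h1)]
  by_cases hx : x ∈ W
  · have : ({1} ×ˢ {1} : Set (G × G)) ∩ {p : G × G | p.1⁻¹ * x * p.2 ∈ W} = {1} ×ˢ {1} := by
      refine Set.inter_eq_left.2 ?_
      rintro ⟨a, b⟩ ⟨rfl, rfl⟩
      simpa using hx
    rw [this, inv_mul_cancel₀ hM]
    simp [hx]
  · have : ({1} ×ˢ {1} : Set (G × G)) ∩ {p : G × G | p.1⁻¹ * x * p.2 ∈ W} = ∅ := by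
      refine Set.eq_empty_of_forall_notMem ?_
      rintro ⟨a, b⟩ ⟨⟨rfl, rfl⟩, h⟩
      exact hx (by simpa using h)
    rw [this]
    simp [hx]

end Smoothing

/-! ### Upper densities and limits along filters -/

section Density

/-- A bounded sequence converges to its upper limit along some ultrafilter. -/
theorem exists_ultrafilter_tendsto_limsup {b : ℕ → ℝ} {c C : ℝ} (hc : ∀ N, c ≤ b N)
    (hC : ∀ N, b N ≤ C) :
    ∃ 𝒰 : Ultrafilter ℕ, (𝒰 : Filter ℕ) ≤ atTop ∧ Tendsto b 𝒰 (𝓝 (limsup b atTop)) := by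
  have hbd : IsBoundedUnder (· ≤ ·) atTop b := isBoundedUnder_of ⟨C, hC⟩
  have hcb : IsCoboundedUnder (· ≤ ·) atTop b :=
    (isBoundedUnder_of (r := (· ≥ ·)) ⟨c, hc⟩).isCoboundedUnder_le
  refine mapClusterPt_iff_ultrafilter.1 (mapClusterPt_iff_frequently.2 fun s hs => ?_)
  obtain ⟨l, u, hlu, hsub⟩ := mem_nhds_iff_exists_Ioo_subset.1 hs
  exact ((frequently_lt_of_lt_limsup hcb hlu.1).and_eventually
    (eventually_lt_of_limsup_lt hlu.2 hbd)).mono fun N hN => hsub hN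

variable {G : Type*} [MeasurableSpace G] {m : Measure G}

theorem setIntegral_mem_Icc {φ : G → ℝ} (hi : Integrable φ m) (hφ : 0 ≤ᵐ[m] φ)
    (h1 : ∫ x, φ x ∂m = 1) (E : Set G) : ∫ x in E, φ x ∂m ∈ Set.Icc (0 : ℝ) 1 :=
  ⟨integral_nonneg_of_ae (ae_restrict_of_ae hφ), h1 ▸ setIntegral_le_integral hi hφ⟩

/-- A limit along any filter finer than `atTop` is at most the upper limit. The general `F` serves
both an ultrafilter, for `μ`, and `atTop` itself, for `ν`. -/
theorem le_upperDensity {F : Filter ℕ} [F.NeBot] (hF : F ≤ atTop) {Ψ : ℕ → G → ℝ}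
    (hi : ∀ N, Integrable (Ψ N) m) (h0 : ∀ N, 0 ≤ᵐ[m] Ψ N) (h1 : ∀ N, ∫ x, Ψ N x ∂m = 1)
    {E : Set G} {a : ℕ → ℝ} {c : ℝ} (ha : Tendsto a F (𝓝 c))
    (hle : ∀ N, a N ≤ ∫ x in E, Ψ N x ∂m) : c ≤ upperDensity m Ψ E := by
  by_contra! hlt
  obtain ⟨d, hd1, hd2⟩ := exists_between hlt
  have hbd : IsBoundedUnder (· ≤ ·) atTop fun N => ∫ x in E, Ψ N x ∂m :=
    isBoundedUnder_of ⟨1, fun N => (setIntegral_mem_Icc (hi N) (h0 N) (h1 N) E).2⟩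
  have h2 : ∀ᶠ N in F, ∫ x in E, Ψ N x ∂m < d := hF (eventually_lt_of_limsup_lt hd1 hbd)
  obtain ⟨N, hN1, hN2⟩ := (h2.and (ha.eventually (lt_mem_nhds hd2))).exists
  exact absurd (hle N) (not_le.2 (hN1.trans hN2))

theorem mem_interTranslates {G : Type*} [Group G] {S : Set G} {n : ℕ} {g h : Fin n → G} {x : G} :
    x ∈ interTranslates S g h ↔ ∀ i, g i * x * (h i)⁻¹ ∈ S := by
  simp only [interTranslates, Set.mem_iInter, Set.mem_image]
  refine forall_congr' fun i => ⟨?_, fun hx => ⟨_, hx, by group⟩⟩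
  rintro ⟨s, hs, rfl⟩
  convert hs using 1
  group

end Density

/-! ### Transfer between densities on the group and measures on the model -/

section Correspondence

theorem exists_state_of_density {G X : Type*} [TopologicalSpace G] [MeasurableSpace G]
    [BorelSpace G] {m : Measure G} [MetricSpace X] [CompactSpace X] [MeasurableSpace X]
    [BorelSpace X] {φ : G → ℝ} (hi : Integrable φ m) (hφ : 0 ≤ᵐ[m] φ)
    (h1 : ∫ x, φ x ∂m = 1) (ι : C(G, X)) :
    ∃ Λ ∈ stateSpace X, ∀ k : C(X, ℝ), Λ k = ∫ x, k (ι x) * φ x ∂m := by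
  have hp : IsProbabilityMeasure (m.withDensity fun x => ENNReal.ofReal (φ x)) := ⟨by
    rw [withDensity_apply _ MeasurableSet.univ, Measure.restrict_univ,
      ← ofReal_integral_eq_lintegral_ofReal hi hφ, h1, ENNReal.ofReal_one]⟩
  have hp' := Measure.isProbabilityMeasure_map
    (μ := m.withDensity fun x => ENNReal.ofReal (φ x)) ι.continuous.measurable.aemeasurable
  obtain ⟨Λ, hΛ, h⟩ := exists_state_of_measure
    ((m.withDensity fun x => ENNReal.ofReal (φ x)).map ι)
  refine ⟨Λ, hΛ, fun k => ?_⟩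
  rw [h, integral_map ι.continuous.measurable.aemeasurable k.continuous.aestronglyMeasurable,
    integral_withDensity_eq_integral_toReal_smul₀ hi.aemeasurable.ennreal_ofReal
      (Eventually.of_forall fun _ => ENNReal.ofReal_lt_top)]
  refine integral_congr_ae ?_
  filter_upwards [hφ] with x hx
  rw [ENNReal.toReal_ofReal hx, smul_eq_mul, mul_comm]

variable {G : Type*} [TopologicalSpace G] [Group G] [IsTopologicalGroup G]
  [LocallyCompactSpace G] [SecondCountableTopology G] [MeasurableSpace G] [BorelSpace G]
  {m : Measure G} [m.IsHaarMeasure]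
  {X : Type*} [MetricSpace X] [CompactSpace X] [MeasurableSpace X] [BorelSpace X]
  [MulAction (G × G) X] [ContinuousSMul (G × G) X]

/-- The product of the translates `L^{g_i} R^{h_i} ξ` as a continuous function. -/
def prodActFun (ξ : C(X, ℝ)) {n : ℕ} (g h : Fin n → G) : C(X, ℝ) where
  toFun x := ∏ i, actFun (g i) (h i) ξ x
  continuous_toFun := by unfold actFun; fun_prop

/-- Along `ι` the product is at most 1, and it vanishes as soon as one translate leaves `V`. The
open set `V` stands between `ξ` and `S` so that the intersection of its translates is measurable. -/
theorem integral_prodActFun_le {ξ : C(X, ℝ)} {ι : C(G, X)}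
    (hι : ∀ (p : G × G) (x : G), ι (p.1 * x * p.2⁻¹) = p • ι x)
    (h0 : ∀ x, 0 ≤ ξ (ι x)) (h1 : ∀ x, ξ (ι x) ≤ 1) {V S : Set G} (hV : IsOpen V) (hVS : V ⊆ S)
    (hξV : ∀ x ∉ V, ξ (ι x) = 0) {φ : G → ℝ} (hi : Integrable φ m) (hφ : 0 ≤ᵐ[m] φ)
    {n : ℕ} (g h : Fin n → G) :
    ∫ x, prodActFun ξ g h (ι x) * φ x ∂m ≤ ∫ x in interTranslates S g h, φ x ∂m := by
  have hval : ∀ x, prodActFun ξ g h (ι x) = ∏ i, ξ (ι (g i * x * (h i)⁻¹)) := fun x => by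
    simp_rw [fun i => hι (g i, h i) x]
    rfl
  have hmeas : MeasurableSet (interTranslates V g h) := by
    have : interTranslates V g h = ⋂ i, (fun x => g i * x * (h i)⁻¹) ⁻¹' V := by
      ext x; simp [mem_interTranslates]
    rw [this]
    exact (isOpen_iInter_of_finite fun i => hV.preimage (by fun_prop)).measurableSet
  have hsub : interTranslates V g h ⊆ interTranslates S g h := fun x hx =>
    mem_interTranslates.2 fun i => hVS (mem_interTranslates.1 hx i)
  refine le_trans ?_ (setIntegral_mono_set hi.integrableOn (ae_restrict_of_ae hφ)
    hsub.eventuallyLE)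
  rw [← integral_indicator hmeas]
  refine integral_mono_ae (integrable_bounded_mul (C := ‖prodActFun ξ g h‖)
    ((prodActFun ξ g h).continuous.comp ι.continuous).measurable
    (fun x => (prodActFun ξ g h).norm_coe_le_norm _) hi) (hi.indicator hmeas) ?_
  filter_upwards [hφ] with x hx
  rw [hval]
  by_cases hxV : x ∈ interTranslates V g h
  · rw [Set.indicator_of_mem hxV]
    exact mul_le_of_le_one_left hx (Finset.prod_le_one (fun i _ => h0 _) fun i _ => h1 _)
  · rw [Set.indicator_of_notMem hxV]
    rw [mem_interTranslates] at hxV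
    push Not at hxV
    obtain ⟨i, hi⟩ := hxV
    rw [Finset.prod_eq_zero (Finset.mem_univ i) (hξV _ hi), zero_mul]

/-- Compactness of the state space gives a limit along the ultrafilter for all `k` at once; the
vanishing translation errors of `Φ` make it invariant. -/
theorem exists_invariant_state {Φ : ℕ → G → ℝ} (hΦ : IsTwoSidedReiter m Φ) {ι : C(G, X)}
    (hι : ∀ (p : G × G) (x : G), ι (p.1 * x * p.2⁻¹) = p • ι x) (𝒰 : Ultrafilter ℕ)
    (h𝒰 : (𝒰 : Filter ℕ) ≤ atTop) :
    ∃ Λ ∈ invariantStates (G × G) X, ∀ k : C(X, ℝ),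
      Tendsto (fun N => ∫ x, k (ι x) * Φ N x ∂m) 𝒰 (𝓝 (Λ k)) := by
  choose Λ hΛ hΛk using fun N =>
    exists_state_of_density (hΦ.integrable N) (hΦ.nonneg N) (hΦ.integral_eq_one N) ι
  obtain ⟨Λ₀, hΛ₀, hlim⟩ := stateSpace_isCompact.ultrafilter_le_nhds' (𝒰.map Λ)
    (Filter.Eventually.of_forall (f := (𝒰 : Filter ℕ)) hΛ)
  have hk : ∀ k : C(X, ℝ), Tendsto (fun N => ∫ x, k (ι x) * Φ N x ∂m) 𝒰 (𝓝 (Λ₀ k)) := fun k => by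
    have := ((WeakDual.eval_continuous k).tendsto Λ₀).comp (show Tendsto Λ 𝒰 (𝓝 Λ₀) from hlim)
    exact this.congr fun N => hΛk N k
  refine ⟨Λ₀, ⟨hΛ₀, fun p k k' hkk' => ?_⟩, hk⟩
  have h1 := (hΦ.tendsto_translate (k := fun x => k (ι x)) (k.continuous.comp ι.continuous).measurable
    (fun x => k.norm_coe_le_norm _) p).mono_left h𝒰
  simp only [hι, ← hkk'] at h1
  exact sub_eq_zero.1 (tendsto_nhds_unique ((hk k').sub (hk k)) h1)

/-- A diagonal choice over a countable dense set of test functions. The defects of `Ψ N` are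
dominated by those of `Φ N`, so the Reiter property is inherited. -/
theorem exists_reiter_tendsto {Φ : ℕ → G → ℝ} (hΦ : IsTwoSidedReiter m Φ) {ι : C(G, X)}
    (hd : DenseRange ι) (hι : ∀ (p : G × G) (x : G), ι (p.1 * x * p.2⁻¹) = p • ι x)
    (ν : Measure X) [IsProbabilityMeasure ν] [SMulInvariantMeasure (G × G) X ν] :
    ∃ Ψ : ℕ → G → ℝ, IsTwoSidedReiter m Ψ ∧ ∀ k : C(X, ℝ),
      Tendsto (fun N => ∫ x, k (ι x) * Ψ N x ∂m) atTop (𝓝 (∫ z, k z ∂ν)) := by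
  let d : ℕ → C(X, ℝ) := TopologicalSpace.denseSeq C(X, ℝ)
  -- The `N`-th density matches `ν` on the first `N` test functions, up to `1 / (N + 1)`.
  choose Ψ hΨ happ using fun N : ℕ =>
    exists_mem_reiterSet_approx (hΦ.integrable N) (hΦ.nonneg N) (hΦ.integral_eq_one N) hd hι ν
      (fun i : Fin N => d i) (ε := 1 / ((N : ℝ) + 1)) Nat.one_div_pos_of_nat
  refine ⟨Ψ, ⟨fun N => (hΨ N).1, fun N => (hΨ N).2.1, fun N => (hΨ N).2.2.1, fun g => ?_,
    fun g => ?_⟩, fun k => ?_⟩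
  · exact squeeze_zero (fun N => integral_nonneg fun x => abs_nonneg _)
      (fun N => (hΨ N).2.2.2.1 g) (hΦ.left g)
  · exact squeeze_zero (fun N => integral_nonneg fun x => abs_nonneg _)
      (fun N => (hΨ N).2.2.2.2 g) (hΦ.right g)
  · refine Metric.tendsto_atTop.2 fun ε hε => ?_
    obtain ⟨i, hi⟩ := (TopologicalSpace.denseRange_denseSeq C(X, ℝ)).exists_dist_lt k
      (show 0 < ε / 3 by positivity)
    rw [dist_eq_norm] at hi
    obtain ⟨N₀, hN₀⟩ := exists_nat_one_div_lt (show 0 < ε / 3 by positivity)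
    refine ⟨max N₀ (i + 1), fun N hN => ?_⟩
    have hN1 : N₀ ≤ N := (le_max_left _ _).trans hN
    have hN2 : i < N := (le_max_right _ _).trans hN
    have hint : ∀ k : C(X, ℝ), Integrable (fun x => k (ι x) * Ψ N x) m := fun k =>
      integrable_bounded_mul (k.continuous.comp ι.continuous).measurable
        (fun y => k.norm_coe_le_norm _) (hΨ N).1
    have e1 : |∫ x, k (ι x) * Ψ N x ∂m - ∫ x, d i (ι x) * Ψ N x ∂m| ≤ ‖k - d i‖ := by
      rw [← integral_sub (hint k) (hint (d i))]
      simp_rw [← sub_mul]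
      refine (abs_integral_mul_le (fun x => (k - d i).norm_coe_le_norm (ι x)) (hΨ N).1).trans_eq ?_
      rw [integral_abs_eq_one (hΨ N).2.1 (hΨ N).2.2.1, mul_one]
    have e2 : |∫ x, d i (ι x) * Ψ N x ∂m - ∫ z, d i z ∂ν| < ε / 3 :=
      (happ N ⟨i, hN2⟩).trans_le ((Nat.one_div_le_one_div hN1).trans hN₀.le)
    have e3 : |∫ z, d i z ∂ν - ∫ z, k z ∂ν| ≤ ‖k - d i‖ := by
      rw [abs_sub_comm, ← integral_sub (k.integrable_of_compactSpace ν)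
        ((d i).integrable_of_compactSpace ν), ← Real.norm_eq_abs]
      refine (norm_integral_le_of_norm_le_const
        (Eventually.of_forall fun x => (k - d i).norm_coe_le_norm x)).trans ?_
      simp
    rw [Real.dist_eq]
    have t1 := abs_sub_le (∫ x, k (ι x) * Ψ N x ∂m) (∫ x, d i (ι x) * Ψ N x ∂m) (∫ z, k z ∂ν)
    have t2 := abs_sub_le (∫ x, d i (ι x) * Ψ N x ∂m) (∫ z, d i z ∂ν) (∫ z, k z ∂ν)
    change ‖k - d i‖ < ε / 3 at hi
    linarith

end Correspondence

/-- A compact neighbourhood of `1` whose elements and their inverses lie in `U`, equal to `{1}` if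
the group is discrete. -/
theorem exists_compact_nhds_one {G : Type*} [TopologicalSpace G] [Group G] [IsTopologicalGroup G]
    [LocallyCompactSpace G] {U : Set G} (hU : IsOpen U) (hU1 : (1 : G) ∈ U) :
    ∃ K : Set G, IsCompact K ∧ K ∈ 𝓝 (1 : G) ∧ K ⊆ U ∧ K⁻¹ ⊆ U ∧
      (DiscreteTopology G → K = {1}) := by
  by_cases hdisc : DiscreteTopology G
  · exact ⟨{1}, isCompact_singleton, by simp, by simpa using hU1, by simpa using hU1, fun _ => rfl⟩
  · obtain ⟨K, hK, hKU, hKc⟩ := LocallyCompactSpace.local_compact_nhds (1 : G) (U ∩ U⁻¹)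
      (inter_mem (hU.mem_nhds hU1) (hU.inv.mem_nhds (by simpa using hU1)))
    exact ⟨K, hKc, hK, fun x hx => (hKU hx).1, fun x hx => by simpa using (hKU hx).2,
      fun h => absurd h hdisc⟩

/-! ### Proof of the correspondence principle -/

theorem mainTheorem8 {G : Type u} [TopologicalSpace G] [Group G] [IsTopologicalGroup G]
    [T2Space G] [LocallyCompactSpace G] [SecondCountableTopology G]
    [MeasurableSpace G] [BorelSpace G]
    (m : Measure G) [m.IsHaarMeasure] (hG : IsAmenableGroup m)
    (Φ : ℕ → G → ℝ) (hΦ : IsTwoSidedReiter m Φ)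
    (W : Set G) (hW : MeasurableSet W)
    (U : Set G) (hU : IsOpen U) (hU1 : (1 : G) ∈ U)
    (S : Set G) (hS : NullMeasurableSet S m) (hUWU : U * W * U ⊆ S) :
    ∃ (X : Type u) (_ : MetricSpace X) (_ : CompactSpace X)
      (_ : MeasurableSpace X) (_ : BorelSpace X)
      (_ : MulAction (G × G) X) (_ : ContinuousSMul (G × G) X)
      (ξ : X → ℝ),
      Continuous ξ ∧ (∀ x, 0 ≤ ξ x) ∧
      (∃ μ : Measure X, IsProbabilityMeasure μ ∧ SMulInvariantMeasure (G × G) X μ ∧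
        ∫ x, ξ x ∂μ = upperDensity m Φ W ∧
        ∀ (n : ℕ) (g h : Fin n → G),
          ∫ x, ∏ i, actFun (g i) (h i) ξ x ∂μ ≤ upperDensity m Φ (interTranslates S g h)) ∧
      (∃ (ν : Measure X) (Ψ : ℕ → G → ℝ), IsProbabilityMeasure ν ∧ ErgodicSMul (G × G) X ν ∧
        IsTwoSidedReiter m Ψ ∧
        upperDensity m Φ W ≤ ∫ x, ξ x ∂ν ∧
        ∀ (n : ℕ) (g h : Fin n → G),
          ∫ x, ∏ i, actFun (g i) (h i) ξ x ∂ν ≤ upperDensity m Ψ (interTranslates S g h)) ∧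
      (DiscreteTopology G → ∃ B : Set X, IsClopen B ∧ ξ = B.indicator 1) := by
  obtain ⟨K, hKc, hK1, hKU, hKU', hKdisc⟩ := exists_compact_nhds_one hU hU1
  have hQc : IsCompact (K ×ˢ K) := hKc.prod hKc
  have hQ0 : (m.prod m) (K ×ˢ K) ≠ 0 :=
    (Measure.measure_pos_of_mem_nhds _ (prod_mem_nhds hK1 hK1)).ne'
  set P : Measure (G × G) := ProbabilityTheory.cond (m.prod m) (K ×ˢ K) with hP
  have hPp : IsProbabilityMeasure P :=
    ProbabilityTheory.cond_isProbabilityMeasure_of_finite hQ0 hQc.measure_ne_top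
  set f : G → ℝ := smoothing P W with hf
  have hf0 : ∀ x, 0 ≤ f x := smoothing_nonneg P W
  have hf1 : ∀ x, f x ≤ 1 := smoothing_le_one P hW
  -- The support lies in `K * W * K⁻¹`, which is why both `K` and `K⁻¹` were chosen inside `U`.
  have hfV : ∀ x ∉ U * W * U, f x = 0 := fun x hx =>
    smoothing_cond_eq_zero hW hKc.measurableSet fun h =>
      hx (Set.mul_subset_mul (Set.mul_subset_mul_right hKU) hKU' h)
  have hV : IsOpen (U * W * U) := hU.mul_left
  obtain ⟨X, hXm, hXc, hXa, hXs, ξ, ι, hd, hι, hξι⟩ :=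
    exists_compact_model (isBiUniform_smoothing (M := m.prod m) hW hQc)
      fun x => abs_le.2 ⟨by linarith [hf0 x], hf1 x⟩
  let _ : MeasurableSpace X := borel X
  have hXb : BorelSpace X := ⟨rfl⟩
  have hprod := fun {φ : G → ℝ} (hi : Integrable φ m) (hφ : 0 ≤ᵐ[m] φ) {n : ℕ} (g h : Fin n → G) =>
    integral_prodActFun_le (ξ := ξ) hι (fun x => (hξι x).symm ▸ hf0 x)
      (fun x => (hξι x).symm ▸ hf1 x) hV hUWU (fun x hx => (hξι x).trans (hfV x hx)) hi hφ g h
  obtain ⟨𝒰, h𝒰, hlim⟩ := exists_ultrafilter_tendsto_limsup (b := fun N => ∫ x in W, Φ N x ∂m)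
    (fun N => (setIntegral_mem_Icc (hΦ.integrable N) (hΦ.nonneg N) (hΦ.integral_eq_one N) W).1)
    (fun N => (setIntegral_mem_Icc (hΦ.integrable N) (hΦ.nonneg N) (hΦ.integral_eq_one N) W).2)
  obtain ⟨Λ, hΛ, hΛk⟩ := exists_invariant_state hΦ hι 𝒰 h𝒰
  -- Smoothing does not change limiting averages, and `𝒰` realises the upper limit for `W`; this
  -- gives equality rather than an inequality.
  have hΛξ : Λ ξ = upperDensity m Φ W := by
    refine tendsto_nhds_unique (hΛk ξ) ?_
    have := ((hΦ.tendsto_smoothing P hW).mono_left h𝒰).add hlim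
    simpa [hξι] using! this
  refine ⟨X, hXm, hXc, _, hXb, hXa, hXs, ξ, ξ.continuous, fun x => ?_, ?_, ?_, fun hdisc => ?_⟩
  · exact hd.induction_on x (isClosed_le continuous_const ξ.continuous) fun y =>
      (hξι y).symm ▸ hf0 y
  · obtain ⟨μ, hμ, hμk⟩ := exists_measure_of_state hΛ.1
    refine ⟨μ, hμ, smulInvariant_of_state hΛ hμk, (hμk ξ).trans hΛξ, fun n g h => ?_⟩
    refine le_upperDensity h𝒰 hΦ.integrable hΦ.nonneg hΦ.integral_eq_one
      (hΛk (prodActFun ξ g h)) (fun N => hprod (hΦ.integrable N) (hΦ.nonneg N) g h) |>.trans' ?_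
    exact (hμk (prodActFun ξ g h)).le
  · obtain ⟨ν, hν, hνe, hνξ⟩ := exists_ergodic_le hΛ ξ
    obtain ⟨Ψ, hΨ, hΨk⟩ := exists_reiter_tendsto hΦ hd hι ν
    refine ⟨ν, Ψ, hν, hνe, hΨ, hΛξ ▸ hνξ, fun n g h => ?_⟩
    exact le_upperDensity le_rfl hΨ.integrable hΨ.nonneg hΨ.integral_eq_one
      (hΨk (prodActFun ξ g h)) (fun N => hprod (hΨ.integrable N) (hΨ.nonneg N) g h)
  -- In the discrete case `K = {1}`, so no smoothing occurs and `ξ` takes only the values 0 and 1 on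
  -- a dense set, hence everywhere.
  · have hfW : ∀ x, f x = W.indicator 1 x := fun x => by
      have hK := hKdisc hdisc
      rw [hf, hP, hK]
      refine smoothing_cond_singleton_one hW (measurableSet_singleton 1) ?_ x
      rw [hK] at hQ0 hQc
      exact ENNReal.toReal_ne_zero.2 ⟨hQ0, hQc.measure_ne_top⟩
    have hval : ∀ x, ξ x = 0 ∨ ξ x = 1 := fun x =>
      hd.induction_on x ((isClosed_eq ξ.continuous continuous_const).union
        (isClosed_eq ξ.continuous continuous_const)) fun y => by
        rw [hξι]
        change f y = 0 ∨ f y = 1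
        rw [hfW]
        by_cases hy : y ∈ W <;> simp [hy]
    -- With only two values, the closed level set is also the preimage of an open ray; any threshold
    -- in [0, 1) would do.
    have heq : ξ ⁻¹' {1} = ξ ⁻¹' Set.Ioi (1 / 2) := by
      ext x
      rcases hval x with h | h <;> simp [h] <;> norm_num
    refine ⟨ξ ⁻¹' {1}, ⟨isClosed_singleton.preimage ξ.continuous,
      heq ▸ isOpen_Ioi.preimage ξ.continuous⟩, funext fun x => ?_⟩
    rcases hval x with h | h <;> simp [h]
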